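/- Let $p$ be an odd prime, $n\ge 1$, $\omega=e^{2\pi i/p}$, and let $X|q\rangle=|q+1\rangle$, $Z|q\rangle=\omega^q|q\rangle$ ($q\in\mathbb Z_p$) be the Pauli operators on $\mathbb C^p$. Let $\mathcal P(p)=\langle X,Z\rangle$ be the Pauli (Heisenberg--Weyl) group, let the single-qudit Clifford group $\mathcal C(p)$ be the normaliser of $\mathcal P(p)$ in $U(\mathbb C^p)$, and let $\mathcal C(p)^{\otimes n}=\{U_1\otimes\cdots\otimes U_n\mid U_k\in\mathcal C(p)\}\le U((\mathbb C^p)^{\otimes n})$ be the local Clifford group. Let $Ax=b \bmod p$, with $A\in\mathrm{Mat}_{r,s}(\mathbb Z_p)$ and $b\in\mathbb Z_p^r$, be a linear constraint system (LCS), and let $\Gamma$ be its solution group: the group generated by $J,g_1,\dots,g_s$ subject to $J^p=g_k^p=1$, $J$ central, $g_kg_{k'}=g_{k'}g_k$ whenever $A_{jk}\ne0\ne A_{jk'}$ for some row $j$, and $\prod_{k=1}^s g_k^{A_{jk}}=J^{b_j}$ for every row $j$. Then the LCS admits a quantum solution in $\mathcal C(p)^{\otimes n}$, i.e. a homomorphism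 $\eta:\Gamma\to\mathcal C(p)^{\otimes n}$ with $\eta(J)=\omega\mathbb 1$, if and only if it admits a classical solution, i.e. a homomorphism $\eta:\Gamma\to\mathbb Z_p$ with $\eta(J)=1$. Equivalently, in terms of operators and vectors: there are $x_1,\dots,x_s\in\mathcal C(p)^{\otimes n}$ with $x_k^p=\mathbb 1$ for all $k$, $x_kx_{k'}=x_{k'}x_k$ whenever $A_{jk}\ne0\ne A_{jk'}$ for some $j$, and $\prod_{k=1}^s x_k^{A_{jk}}=\omega^{b_j}\mathbb 1$ for all $j$, if and only if there is $\tilde x\in\mathbb Z_p^s$ with $A\tilde x=b$. -/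

import Mathlib

open scoped Matrix

noncomputable section

namespace LCS

/-! ### Linear constraint systems over `ℤ_d` and their solution groups -/

/-- The ordered product `x₁ ^ c₁ * x₂ ^ c₂ * ⋯ * xₛ ^ cₛ` for exponents `c_k ∈ ℤ_d`, each represented
by its residue in `{0, …, d - 1}`. -/
def rowProd {G : Type*} [Monoid G] {d s : ℕ} (c : Fin s → ZMod d) (x : Fin s → G) : G :=
  (List.ofFn fun k => x k ^ (c k).val).prod

/-- Generators of the solution group of a linear constraint system in `s` variables. -/
inductive Gen (s : ℕ) : Type
  | J : Gen s
  | var (k : Fin s) : Gen s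

/-- The generator `J` as an element of the free group. -/
def freeJ (s : ℕ) : FreeGroup (Gen s) := FreeGroup.of Gen.J

/-- The generator `g_k` as an element of the free group. -/
def freeVar {s : ℕ} (k : Fin s) : FreeGroup (Gen s) := FreeGroup.of (Gen.var k)

/-- The relators of the solution group of the linear constraint system `A x = b mod d`. -/
inductive IsRelator {d r s : ℕ} (A : Matrix (Fin r) (Fin s) (ZMod d)) (b : Fin r → ZMod d) :
    FreeGroup (Gen s) → Prop
  | J_torsion : IsRelator A b (freeJ s ^ d)
  | var_torsion (k : Fin s) : IsRelator A b (freeVar k ^ d)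
  | J_central (k : Fin s) :
      IsRelator A b (freeJ s * freeVar k * (freeJ s)⁻¹ * (freeVar k)⁻¹)
  | var_comm (j : Fin r) (k k' : Fin s) (hk : A j k ≠ 0) (hk' : A j k' ≠ 0) :
      IsRelator A b (freeVar k * freeVar k' * (freeVar k)⁻¹ * (freeVar k')⁻¹)
  | row (j : Fin r) :
      IsRelator A b (rowProd (A j) (freeVar (s := s)) * (freeJ s ^ (b j).val)⁻¹)

/-- The solution group `Γ` of the linear constraint system `A x = b mod d`: it is generated by
`J, g₁, …, gₛ` subject to `J ^ d = g_k ^ d = 1`, `J` is central, `g_k` and `g_k'` commute whenever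
they occur in a common row of `A`, and `∏ₖ g_k ^ A_jk = J ^ b_j` for every row `j`. -/
abbrev SolutionGroup {d r s : ℕ} (A : Matrix (Fin r) (Fin s) (ZMod d)) (b : Fin r → ZMod d) :
    Type :=
  PresentedGroup {w : FreeGroup (Gen s) | IsRelator A b w}

/-- The distinguished central element `J` of the solution group. -/
def SolutionGroup.J {d r s : ℕ} (A : Matrix (Fin r) (Fin s) (ZMod d)) (b : Fin r → ZMod d) :
    SolutionGroup A b :=
  PresentedGroup.of Gen.J

/-! ### Qudit unitaries -/

/-- The primitive root of unity `ω = exp(2πi / d)`. -/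
def omega (d : ℕ) : ℂ := Complex.exp (2 * Real.pi * Complex.I / d)

/-- The matrix of the Pauli operator `X |q⟩ = |q + 1⟩`. -/
def matX (d : ℕ) : Matrix (ZMod d) (ZMod d) ℂ :=
  Matrix.of fun i q => if i = q + 1 then 1 else 0

/-- The matrix of the Pauli operator `Z |q⟩ = ω ^ q |q⟩`. -/
def matZ (d : ℕ) : Matrix (ZMod d) (ZMod d) ℂ :=
  Matrix.diagonal fun q => omega d ^ q.val

theorem star_omega_mul (d : ℕ) : star (omega d) * omega d = 1 := by
  have h : ‖omega d‖ = 1 := by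
    have := Complex.norm_exp_ofReal_mul_I (2 * Real.pi / d)
    rw [omega, ← this]
    congr 2
    push_cast
    ring
  have h2 := Complex.normSq_eq_conj_mul_self (z := omega d)
  rw [Complex.normSq_eq_norm_sq, h] at h2
  simpa using h2.symm

theorem matX_mem (d : ℕ) [NeZero d] : matX d ∈ Matrix.unitaryGroup (ZMod d) ℂ := by
  rw [Matrix.mem_unitaryGroup_iff']
  ext i j
  simp only [Matrix.mul_apply, Matrix.star_apply, matX, Matrix.of_apply, Matrix.one_apply]
  rw [Finset.sum_eq_single (i + 1)]
  · by_cases h : i = j <;> simp [h]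
  · intro k _ hk
    simp [hk]
  · simp

theorem matZ_mem (d : ℕ) [NeZero d] : matZ d ∈ Matrix.unitaryGroup (ZMod d) ℂ := by
  rw [Matrix.mem_unitaryGroup_iff', matZ, Matrix.star_eq_conjTranspose,
    Matrix.diagonal_conjTranspose, Matrix.diagonal_mul_diagonal, ← Matrix.diagonal_one]
  congr 1
  funext q
  simp only [Pi.star_apply, star_pow]
  rw [← mul_pow, star_omega_mul, one_pow]

/-- The Pauli operator `X` as a unitary. -/
def pauliX (d : ℕ) [NeZero d] : Matrix.unitaryGroup (ZMod d) ℂ := ⟨matX d, matX_mem d⟩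

/-- The Pauli operator `Z` as a unitary. -/
def pauliZ (d : ℕ) [NeZero d] : Matrix.unitaryGroup (ZMod d) ℂ := ⟨matZ d, matZ_mem d⟩

/-- The single-qudit Pauli group for odd `d`, i.e. the Heisenberg-Weyl group
`{ω ^ c Z ^ b X ^ a | a, b, c ∈ ℤ_d}` generated by `X` and `Z`. -/
def pauliGroup (d : ℕ) [NeZero d] : Subgroup (Matrix.unitaryGroup (ZMod d) ℂ) :=
  Subgroup.closure {pauliX d, pauliZ d}

/-- The single-qudit Clifford group: the normaliser of the Pauli group in the unitary group. -/
def cliffordGroup (d : ℕ) [NeZero d] : Subgroup (Matrix.unitaryGroup (ZMod d) ℂ) :=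
  Subgroup.normalizer (pauliGroup d : Set (Matrix.unitaryGroup (ZMod d) ℂ))

/-- The matrix of `M₁ ⊗ ⋯ ⊗ Mₙ` in the product basis `|q₁⟩ ⊗ ⋯ ⊗ |qₙ⟩`, indexed by
`q : Fin n → ℤ_d`. -/
def tensorMatrix {d n : ℕ} (M : Fin n → Matrix (ZMod d) (ZMod d) ℂ) :
    Matrix (Fin n → ZMod d) (Fin n → ZMod d) ℂ :=
  Matrix.of fun i j => ∏ k, M k (i k) (j k)

theorem tensorMatrix_mul {d n : ℕ} [NeZero d] (M N : Fin n → Matrix (ZMod d) (ZMod d) ℂ) :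
    tensorMatrix (fun k => M k * N k) = tensorMatrix M * tensorMatrix N := by
  ext i j
  simp only [tensorMatrix, Matrix.mul_apply, Matrix.of_apply]
  rw [Fintype.prod_sum]
  exact Finset.sum_congr rfl fun q _ => Finset.prod_mul_distrib

theorem tensorMatrix_one (d n : ℕ) :
    tensorMatrix (fun _ : Fin n => (1 : Matrix (ZMod d) (ZMod d) ℂ)) = 1 := by
  ext i j
  simp only [tensorMatrix, Matrix.of_apply, Matrix.one_apply]
  by_cases h : i = j
  · simp [h]
  · obtain ⟨k, hk⟩ := Function.ne_iff.mp h
    rw [if_neg h]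
    exact Finset.prod_eq_zero (Finset.mem_univ k) (if_neg hk)

theorem star_tensorMatrix {d n : ℕ} (M : Fin n → Matrix (ZMod d) (ZMod d) ℂ) :
    star (tensorMatrix M) = tensorMatrix fun k => star (M k) := by
  ext i j
  simp [tensorMatrix, Matrix.star_apply]

/-- The homomorphism `(U₁, …, Uₙ) ↦ U₁ ⊗ ⋯ ⊗ Uₙ`. -/
def tensorHom (d n : ℕ) [NeZero d] :
    (Fin n → Matrix.unitaryGroup (ZMod d) ℂ) →* Matrix.unitaryGroup (Fin n → ZMod d) ℂ where
  toFun U := ⟨tensorMatrix fun k => (U k : Matrix (ZMod d) (ZMod d) ℂ), by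
    rw [Matrix.mem_unitaryGroup_iff', star_tensorMatrix, ← tensorMatrix_mul,
      ← tensorMatrix_one d n]
    congr 1
    funext k
    exact Matrix.mem_unitaryGroup_iff'.mp (U k).2⟩
  map_one' := Subtype.ext (tensorMatrix_one d n)
  map_mul' U V := Subtype.ext (tensorMatrix_mul _ _)

/-- The local Clifford group `𝒞(d)^{⊗n}`: all `U₁ ⊗ ⋯ ⊗ Uₙ` with every `U_k` in the single-qudit
Clifford group. -/
def localClifford (d n : ℕ) [NeZero d] : Subgroup (Matrix.unitaryGroup (Fin n → ZMod d) ℂ) :=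
  (Subgroup.pi Set.univ fun _ => cliffordGroup d).map (tensorHom d n)

/-! ### Classical and quantum solutions -/

/-- A classical solution of `A x = b mod d`. -/
def IsClassicalSolution {d r s : ℕ} (A : Matrix (Fin r) (Fin s) (ZMod d)) (b : Fin r → ZMod d)
    (x : Fin s → ZMod d) : Prop :=
  A *ᵥ x = b

/-- A quantum solution of `A x = b mod d` by unitaries on a finite-dimensional Hilbert space. -/
structure IsQuantumSolution {d r s : ℕ} {ι : Type*} [Fintype ι] [DecidableEq ι]
    (A : Matrix (Fin r) (Fin s) (ZMod d)) (b : Fin r → ZMod d)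
    (x : Fin s → Matrix.unitaryGroup ι ℂ) : Prop where
  torsion : ∀ k, x k ^ d = 1
  comm : ∀ j k k', A j k ≠ 0 → A j k' ≠ 0 → Commute (x k) (x k')
  constraint : ∀ j, ((rowProd (A j) x : Matrix.unitaryGroup ι ℂ) : Matrix ι ι ℂ) =
    omega d ^ (b j).val • (1 : Matrix ι ι ℂ)

/-- A classical solution as a homomorphism `η : Γ → ℤ_d`: it maps `J` to the generator `1`. -/
def IsClassicalHom {d r s : ℕ} {A : Matrix (Fin r) (Fin s) (ZMod d)} {b : Fin r → ZMod d}
    (η : SolutionGroup A b →* Multiplicative (ZMod d)) : Prop :=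
  η (SolutionGroup.J A b) = Multiplicative.ofAdd 1

/-- A quantum solution as a homomorphism `η : Γ → G` into a group of unitaries: it maps `J` to
`ω 𝟙`. -/
def IsQuantumHom {d r s : ℕ} {ι : Type*} [Fintype ι] [DecidableEq ι]
    {A : Matrix (Fin r) (Fin s) (ZMod d)} {b : Fin r → ZMod d}
    {G : Subgroup (Matrix.unitaryGroup ι ℂ)} (η : SolutionGroup A b →* G) : Prop :=
  ((η (SolutionGroup.J A b) : Matrix.unitaryGroup ι ℂ) : Matrix ι ι ℂ) =
    omega d • (1 : Matrix ι ι ℂ)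

end LCS

end

/-! The converse direction is easy: a classical solution maps `Γ` to `ℤ_p`, and `ℤ_p` embeds as the
scalars `ω ^ t`. The content is to turn local Clifford operators into numbers. It suffices to find a
function `F` to the unit circle, defined on the relevant tensor products, that fixes scalars and is
multiplicative on commuting pairs. Applied to a quantum solution, `F` gives `p`-th roots of unity `ω
^ t_k`, and each row equation becomes `A t = b`.

Tensor products commute exactly when their factors commute up to phases `ζ_i` with product `1`. So
`F` can be a product of single-qudit functions `φ` satisfying the twisted law `φ (U V) = ζ ^ h φ U φ
V` whenever `U V = ζ V U`, with `h = (p + 1) / 2`: the factors `ζ_i ^ h` cancel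
(`exists_phase_tensorTorsionSet`).

On scalar multiples of Weyl operators, `φ` reads off the scalar; the law holds because the Weyl
cocycle is half the commutation phase, which is where `p` odd enters. A Clifford element of order
`p` modulo scalars acts on `ℤ_p²` by a unipotent map. If the action is nontrivial, whatever has the
same torsion and commutes with `U` up to phase is a Weyl operator times a power of `U`
(`exists_eq_mul_zpow`), and the Weyl operators that commute with `U` up to phase commute with each
other (`weylGroup_commute`). Hence commutation up to phase partitions the non-Weyl elements into
classes, and `φ` extends to each class by choosing a representative `R` and a `p`-th root of the
scalar `R ^ p` (`exists_phase`). -/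

noncomputable section

namespace LCS

/-! ### Commutation up to central phases, and extension of phase functions -/

section Phase

variable {G K : Type*} [Group G] [CommGroup K]

/-- `U` and `V` commute up to the central element `ι ζ`. -/
def TwistCommute (ι : K →* G) (ζ : K) (U V : G) : Prop := U * V = ι ζ * (V * U)

namespace TwistCommute

variable {ι : K →* G} {ζ ζ' : K} {U V V' : G}

theorem iff_conj : TwistCommute ι ζ U V ↔ U * V * U⁻¹ = ι ζ * V := by
  rw [TwistCommute, mul_inv_eq_iff_eq_mul, mul_assoc (ι ζ)]

theorem one_iff : TwistCommute ι 1 U V ↔ Commute U V := by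
  simp [TwistCommute, Commute, SemiconjBy]

theorem refl (ι : K →* G) (U : G) : TwistCommute ι 1 U U := one_iff.2 (Commute.refl U)

theorem symm (h : TwistCommute ι ζ U V) : TwistCommute ι ζ⁻¹ V U := by
  rw [TwistCommute] at *
  rw [h, map_inv, inv_mul_cancel_left]

variable (hι : ∀ k g, Commute (ι k) g)
include hι

theorem mul_right (h : TwistCommute ι ζ U V) (h' : TwistCommute ι ζ' U V') :
    TwistCommute ι (ζ * ζ') U (V * V') := by
  rw [iff_conj] at *
  have : U * (V * V') * U⁻¹ = (U * V * U⁻¹) * (U * V' * U⁻¹) := by group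
  rw [this, h, h', map_mul, mul_assoc, mul_assoc, ← mul_assoc V, ← (hι ζ' V).eq, mul_assoc]

theorem mul_left (h : TwistCommute ι ζ V U) (h' : TwistCommute ι ζ' V' U) :
    TwistCommute ι (ζ * ζ') (V * V') U := by
  have := (mul_right hι h.symm h'.symm).symm
  rwa [← mul_inv, inv_inv] at this

theorem zpow_right (h : TwistCommute ι ζ U V) (m : ℤ) : TwistCommute ι (ζ ^ m) U (V ^ m) := by
  rw [iff_conj] at *
  rw [← conj_zpow, h, (hι ζ V).mul_zpow, map_zpow]

theorem zpow_left (h : TwistCommute ι ζ V U) (m : ℤ) : TwistCommute ι (ζ ^ m) (V ^ m) U := by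
  have := (zpow_right hι h.symm m).symm
  rwa [inv_zpow, inv_inv] at this

theorem central_left (k : K) (g : G) : TwistCommute ι 1 (ι k) g := one_iff.2 (hι k g)

theorem central_right (k : K) (g : G) : TwistCommute ι 1 g (ι k) := one_iff.2 (hι k g).symm

omit hι in
theorem unique (hinj : Function.Injective ι) (h : TwistCommute ι ζ U V)
    (h' : TwistCommute ι ζ' U V) : ζ = ζ' := by
  rw [TwistCommute] at *
  rw [h] at h'
  exact hinj (mul_right_cancel h')

/-- Conjugation by `U` multiplies `V ^ p` by `ζ ^ p`, yet fixes it because it is central. -/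
theorem pow_eq_one (hinj : Function.Injective ι) (h : TwistCommute ι ζ U V) {p : ℕ} {k : K}
    (hV : V ^ p = ι k) : ζ ^ p = 1 := by
  have := zpow_right hι h p
  rw [zpow_natCast, zpow_natCast, hV] at this
  exact unique hinj this (central_right hι k U)

end TwistCommute

/-- The values at `U = Q R ^ m`, with `Q ∈ P`, of the phase function that extends `ψ` from `P` and
takes the value `c` at `R`. -/
def ExtValue (ι : K →* G) (P : Subgroup G) (ψ : G → K) (h : ℕ) (R : G) (c : K) (U : G) (k : K) :
    Prop :=
  ∃ Q ∈ P, ∃ (η : K) (m : ℤ), TwistCommute ι η Q R ∧ U = Q * R ^ m ∧ k = (η ^ h) ^ m * ψ Q * c ^ m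

variable {ι : K →* G} {P : Subgroup G} {ψ : G → K} {p h : ℕ} {R : G} {c : K}

theorem ExtValue.of_mem {Q : G} (hQ : Q ∈ P) {η : K} (hη : TwistCommute ι η Q R) :
    ExtValue ι P ψ h R c Q (ψ Q) :=
  ⟨Q, hQ, η, 0, hη, by simp, by simp⟩

/-- Since `Q` and `Q'` commute, the phase between `Q R ^ m` and `Q' R ^ m'` is `η ^ m' η' ^ (-m)`.
Reordering the product costs the full phase `η' ^ (-m)`; the half-phases `η ^ h` in the definition
of the value are what balance this against `ζ ^ h`. -/
theorem ExtValue.mul (hι : ∀ k g, Commute (ι k) g) (hinj : Function.Injective ι)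
    (hιP : ∀ k, ι k ∈ P) (hψι : ∀ k, ψ (ι k) = k)
    (hψ : ∀ Q ∈ P, ∀ Q' ∈ P, Commute Q Q' → ψ (Q * Q') = ψ Q * ψ Q')
    (hh : ∀ η : K, η ^ p = 1 → (η ^ h) ^ 2 = η) {d : K} (hR : R ^ p = ι d)
    (hcomm : ∀ Q ∈ P, ∀ Q' ∈ P, ∀ η η', TwistCommute ι η Q R → TwistCommute ι η' Q' R →
      Commute Q Q') {U V : G} {k l ζ : K} (hU : ExtValue ι P ψ h R c U k)
    (hV : ExtValue ι P ψ h R c V l) (hUV : TwistCommute ι ζ U V) :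
    ExtValue ι P ψ h R c (U * V) (ζ ^ h * k * l) := by
  obtain ⟨Q, hQ, η, m, hη, rfl, rfl⟩ := hU
  obtain ⟨Q', hQ', η', m', hη', rfl, rfl⟩ := hV
  have hc := hcomm Q hQ Q' hQ' η η' hη hη'
  have e' : R ^ m * Q' = ι (η' ^ m)⁻¹ * (Q' * R ^ m) := (hη'.zpow_right hι m).symm
  have hζ : ζ = η ^ m' * (η' ^ m)⁻¹ := by
    refine hUV.unique hinj ?_
    have h1 := (TwistCommute.one_iff (ι := ι)).2 hc
    have h2 := hη.zpow_right hι m'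
    have h3 := (hη'.zpow_right hι m).symm
    have h4 : TwistCommute ι 1 (R ^ m) (R ^ m') :=
      TwistCommute.one_iff.2 ((Commute.refl R).zpow_zpow m m')
    have := (h1.mul_right hι h2).mul_left hι (h3.mul_right hι h4)
    simpa using this
  have hη1 : η' ^ p = 1 := hη'.pow_eq_one hι hinj hR
  refine ⟨ι (η' ^ m)⁻¹ * (Q * Q'), P.mul_mem (hιP _) (P.mul_mem hQ hQ'), η * η', m + m', ?_, ?_, ?_⟩
  · have := (TwistCommute.central_left hι (η' ^ m)⁻¹ R).mul_left hι (hη.mul_left hι hη')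
    simpa using this
  · rw [mul_assoc Q, ← mul_assoc (R ^ m), e', zpow_add]
    simp only [← mul_assoc]
    rw [(hι _ Q).eq]
  · rw [hψ _ (hιP _) _ (P.mul_mem hQ hQ') (hι _ _), hψι, hψ _ hQ _ hQ' hc, hζ]
    simp only [mul_pow, mul_zpow, zpow_add, inv_pow]
    have e1 : (η ^ m') ^ h = (η ^ h) ^ m' := by
      rw [← zpow_natCast, ← zpow_natCast, zpow_comm]
    have e2 : (η' ^ m) ^ h = (η' ^ h) ^ m := by
      rw [← zpow_natCast, ← zpow_natCast, zpow_comm]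
    have e3 : η' ^ m = (η' ^ h) ^ m * (η' ^ h) ^ m := by rw [← mul_zpow, ← sq, hh η' hη1]
    rw [e1, e2, e3]
    apply Additive.ofMul.injective
    simp only [ofMul_mul, ofMul_inv]
    abel

/-- Bézout for `p` and `m`: both `R ^ p` and `R ^ m` lie in `P`. -/
theorem mem_of_zpow_mem (hp : p.Prime) (hιP : ∀ k, ι k ∈ P) {d : K} (hR : R ^ p = ι d) {m : ℤ}
    (hm : R ^ m ∈ P) (hpm : ¬ (p : ℤ) ∣ m) : R ∈ P := by
  obtain ⟨u, v, huv⟩ : IsCoprime (p : ℤ) m :=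
    (Nat.prime_iff_prime_int.1 hp).irreducible.coprime_iff_not_dvd.2 hpm
  have : R = (R ^ p) ^ u * (R ^ m) ^ v := by
    rw [← zpow_natCast, ← zpow_mul, ← zpow_mul, ← zpow_add, mul_comm (p : ℤ), mul_comm m, huv,
      zpow_one]
  rw [this, hR]
  exact P.mul_mem (P.zpow_mem (hιP d) u) (P.zpow_mem hm v)

/-- Two decompositions differ by a power of `R` lying in `P`, so the exponents agree modulo `p`.
That power is then central and equals the same power of `c`, because `c ^ p` is the value of `R ^
p`; the phase factor is unaffected since `η ^ p = 1`. -/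
theorem ExtValue.unique (hp : p.Prime) (hι : ∀ k g, Commute (ι k) g)
    (hinj : Function.Injective ι) (hιP : ∀ k, ι k ∈ P) (hψι : ∀ k, ψ (ι k) = k)
    (hψ : ∀ Q ∈ P, ∀ Q' ∈ P, Commute Q Q' → ψ (Q * Q') = ψ Q * ψ Q') (hR : R ^ p = ι (c ^ p))
    (hRP : R ∉ P) {U : G} {k l : K} (hk : ExtValue ι P ψ h R c U k)
    (hl : ExtValue ι P ψ h R c U l) : k = l := by
  obtain ⟨Q, hQ, η, m, hη, hU, rfl⟩ := hk
  obtain ⟨Q', hQ', η', m', hη', hU', rfl⟩ := hl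
  have e : Q' = Q * R ^ (m - m') := by
    rw [zpow_sub, ← mul_assoc, ← hU, hU', mul_inv_cancel_right]
  have hmem : R ^ (m - m') ∈ P := by
    have := P.mul_mem (P.inv_mem hQ) hQ'
    rwa [e, inv_mul_cancel_left] at this
  obtain ⟨t, ht⟩ : (p : ℤ) ∣ m - m' := by
    by_contra hcon
    exact hRP (mem_of_zpow_mem hp hιP hR hmem hcon)
  have e2 : R ^ (m - m') = ι (c ^ (m - m')) := by
    rw [ht, zpow_mul, zpow_natCast, hR, ← map_zpow, zpow_mul, zpow_natCast]
  rw [e2] at e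
  have hηη : η' = η := by
    refine hη'.unique hinj ?_
    rw [e]
    simpa only [mul_one] using hη.mul_left hι (TwistCommute.central_left hι _ R)
  have hη1 : η ^ p = 1 := hη.pow_eq_one hι hinj hR
  have hm : (η ^ h) ^ m = (η ^ h) ^ m' := by
    have : m = m' + p * t := by omega
    rw [this, zpow_add, zpow_mul (η ^ h), zpow_natCast (η ^ h), pow_right_comm, hη1]
    simp
  rw [hηη, e, hψ _ hQ _ (hιP _) (hι _ _).symm, hψι, hm, zpow_sub]
  apply Additive.ofMul.injective
  simp only [ofMul_mul, ofMul_inv]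
  abel

/-- A phase function on a subgroup `P` extends to a set `E` of elements of order `p` modulo central
elements, provided that `P` splits off as follows: elements of `E ∖ P` that commute up to a phase
generate each other modulo `P`, and elements of `P` commute if they commute up to a phase with an
element of `E ∖ P`. -/
theorem exists_phase (hp : p.Prime) (hι : ∀ k g, Commute (ι k) g)
    (hinj : Function.Injective ι) (hroot : ∀ k : K, ∃ c, c ^ p = k)
    (hh : ∀ η : K, η ^ p = 1 → (η ^ h) ^ 2 = η)
    (hιP : ∀ k, ι k ∈ P) (hψι : ∀ k, ψ (ι k) = k)
    (hψ : ∀ Q ∈ P, ∀ Q' ∈ P, ∀ ζ, TwistCommute ι ζ Q Q' → ψ (Q * Q') = ζ ^ h * ψ Q * ψ Q')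
    (hPP : ∀ Q ∈ P, ∀ Q' ∈ P, ∃ ζ, TwistCommute ι ζ Q Q')
    {E : Set G} (hE : ∀ U ∈ E, ∃ d, U ^ p = ι d)
    (hEmul : ∀ U ∈ E, ∀ V ∈ E, ∀ ζ, TwistCommute ι ζ U V → U * V ∈ E)
    (hgen : ∀ U ∈ E, U ∉ P → ∀ V ∈ E, ∀ ζ, TwistCommute ι ζ U V → ∃ Q ∈ P, ∃ m : ℤ, V = Q * U ^ m)
    (hcomm : ∀ U ∈ E, U ∉ P → ∀ Q ∈ P, ∀ Q' ∈ P, ∀ η η', TwistCommute ι η Q U →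
      TwistCommute ι η' Q' U → Commute Q Q') :
    ∃ φ : G → K, (∀ k, φ (ι k) = k) ∧
      ∀ U ∈ E, ∀ V ∈ E, ∀ ζ, TwistCommute ι ζ U V → φ (U * V) = ζ ^ h * φ U * φ V := by
  classical
  have hψ1 : ∀ Q ∈ P, ∀ Q' ∈ P, Commute Q Q' → ψ (Q * Q') = ψ Q * ψ Q' := by
    intro Q hQ Q' hQ' hc
    simpa using hψ Q hQ Q' hQ' 1 (TwistCommute.one_iff.2 hc)
  -- whatever commutes with `V` up to a phase does so with `U`
  have htrans : ∀ U ∈ E, U ∉ P → ∀ V ∈ E, V ∉ P → ∀ W ∈ E, (∃ ζ, TwistCommute ι ζ U V) →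
      (∃ ζ, TwistCommute ι ζ V W) → ∃ ζ, TwistCommute ι ζ U W := by
    rintro U hU hUP V hV hVP W hW ⟨ζ, hζ⟩ ⟨ξ, hξ⟩
    obtain ⟨Q, hQ, m, rfl⟩ := hgen V hV hVP W hW ξ hξ
    obtain ⟨Q', hQ', m', rfl⟩ := hgen V hV hVP U hU _ hζ.symm
    -- Cancelling the power of `V` reduces transitivity to elements of `P`, any two of which commute
    -- up to a phase.
    have key : ∀ Q ∈ P, ∀ m : ℤ, (∃ ζ, TwistCommute ι ζ V (Q * V ^ m)) →
        ∃ ζ, TwistCommute ι ζ V Q := by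
      rintro Q - m ⟨ζ, hζ⟩
      refine ⟨ζ * 1 ^ (-m), ?_⟩
      have := hζ.mul_right hι ((TwistCommute.refl ι V).zpow_right hι (-m))
      rwa [mul_assoc, ← zpow_add, add_neg_cancel, zpow_zero, mul_one] at this
    obtain ⟨α, hα⟩ := key Q hQ m ⟨_, hξ⟩
    obtain ⟨β, hβ⟩ := key Q' hQ' m' ⟨_, hζ.symm⟩
    obtain ⟨γ, hγ⟩ := hPP Q' hQ' Q hQ
    exact ⟨_, (hγ.mul_right hι (hβ.symm.zpow_right hι m)).mul_left hι
      ((hα.mul_right hι ((TwistCommute.refl ι V).zpow_right hι m)).zpow_left hι m')⟩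
  let S : Setoid {U : G // U ∈ E ∧ U ∉ P} :=
    { r := fun U V => ∃ ζ, TwistCommute ι ζ U.1 V.1
      iseqv :=
        { refl := fun U => ⟨1, TwistCommute.refl ι U.1⟩
          symm := fun ⟨ζ, hζ⟩ => ⟨_, hζ.symm⟩
          trans := fun {U V W} h1 h2 =>
            htrans U.1 U.2.1 U.2.2 V.1 V.2.1 V.2.2 W.1 W.2.1 h1 h2 } }
  have hc0 : ∀ R : {U : G // U ∈ E ∧ U ∉ P}, ∃ c : K, R.1 ^ p = ι (c ^ p) := by
    intro R
    obtain ⟨d, hd⟩ := hE R.1 R.2.1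
    obtain ⟨c, rfl⟩ := hroot d
    exact ⟨c, hd⟩
  choose c hc using hc0
  let rep : {U : G // U ∈ E ∧ U ∉ P} → {U : G // U ∈ E ∧ U ∉ P} :=
    fun U => (Quotient.mk S U).out
  have hrep : ∀ U, ∃ ζ, TwistCommute ι ζ (rep U).1 U.1 := fun U =>
    Quotient.exact (s := S) (Quotient.out_eq (Quotient.mk S U))
  have hrep' : ∀ U V, (∃ ζ, TwistCommute ι ζ U.1 V.1) → rep U = rep V := fun U V hUV =>
    congrArg Quotient.out (Quotient.sound (s := S) hUV)
  have hval : ∀ R : {U : G // U ∈ E ∧ U ∉ P}, ∀ U ∈ E, (∃ ζ, TwistCommute ι ζ R.1 U) →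
      ∃ k, ExtValue ι P ψ h R.1 (c R) U k := by
    rintro R U hU ⟨ζ, hζ⟩
    obtain ⟨Q, hQ, m, rfl⟩ := hgen R.1 R.2.1 R.2.2 U hU ζ hζ
    have := hζ.mul_right hι ((TwistCommute.refl ι R.1).zpow_right hι (-m))
    rw [mul_assoc, ← zpow_add, add_neg_cancel, zpow_zero, mul_one] at this
    exact ⟨_, Q, hQ, _, m, this.symm, rfl, rfl⟩
  choose val hval using fun U : {U : G // U ∈ E ∧ U ∉ P} => hval (rep U) U.1 U.2.1 (hrep U)
  let φ : G → K := fun U => if hU : U ∈ E ∧ U ∉ P then val ⟨U, hU⟩ else ψ U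
  have hφP : ∀ Q ∈ P, φ Q = ψ Q := fun Q hQ => dif_neg fun hcon => hcon.2 hQ
  have hφ : ∀ R, (rep R).1 = R.1 → ∀ U ∈ E, (∃ ζ, TwistCommute ι ζ R.1 U) →
      ExtValue ι P ψ h R.1 (c R) U (φ U) := by
    rintro R hR U hU ⟨ζ, hζ⟩
    by_cases hUP : U ∈ P
    · rw [hφP U hUP]
      exact ExtValue.of_mem hUP hζ.symm
    · have h1 : φ U = val ⟨U, hU, hUP⟩ := dif_pos ⟨hU, hUP⟩
      have h2 : rep ⟨U, hU, hUP⟩ = R := by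
        rw [← hrep' R ⟨U, hU, hUP⟩ ⟨ζ, hζ⟩]
        exact Subtype.ext hR
      have := hval ⟨U, hU, hUP⟩
      rwa [h2, ← h1] at this
  have hrr : ∀ U, rep (rep U) = rep U := fun U => hrep' _ _ (hrep U)
  refine ⟨φ, fun k => by rw [hφP _ (hιP k), hψι], ?_⟩
  -- `X` will be whichever of `U`, `V` lies outside `P`. All of `U`, `V`, `U * V` can then be
  -- evaluated through the one representative of the class of `X`, even if some of them lie in `P`.
  have main : ∀ X : {U : G // U ∈ E ∧ U ∉ P}, ∀ U ∈ E, ∀ V ∈ E, ∀ ζ, TwistCommute ι ζ U V →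
      (∃ α, TwistCommute ι α X.1 U) → (∃ α, TwistCommute ι α X.1 V) →
      φ (U * V) = ζ ^ h * φ U * φ V := by
    intro X U hU V hV ζ hζ hXU hXV
    have hRX : ∃ α, TwistCommute ι α (rep X).1 X.1 := hrep X
    have a1 := htrans (rep X).1 (rep X).2.1 (rep X).2.2 X.1 X.2.1 X.2.2 U hU hRX hXU
    have a2 := htrans (rep X).1 (rep X).2.1 (rep X).2.2 X.1 X.2.1 X.2.2 V hV hRX hXV
    have a3 : ∃ α, TwistCommute ι α (rep X).1 (U * V) := by
      obtain ⟨_, h1⟩ := a1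
      obtain ⟨_, h2⟩ := a2
      exact ⟨_, h1.mul_right hι h2⟩
    have e : (rep (rep X)).1 = (rep X).1 := congrArg Subtype.val (hrr X)
    have b1 := hφ (rep X) e U hU a1
    have b2 := hφ (rep X) e V hV a2
    have b3 := hφ (rep X) e (U * V) (hEmul U hU V hV ζ hζ) a3
    refine b3.unique hp hι hinj hιP hψι hψ1 (hc _) (rep X).2.2 ?_
    exact b1.mul hι hinj hιP hψι hψ1 hh (hc _) (hcomm _ (rep X).2.1 (rep X).2.2) b2 hζ
  intro U hU V hV ζ hζ
  by_cases hUP : U ∈ P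
  · by_cases hVP : V ∈ P
    · rw [hφP _ hUP, hφP _ hVP, hφP _ (P.mul_mem hUP hVP)]
      exact hψ U hUP V hVP ζ hζ
    · exact main ⟨V, hV, hVP⟩ U hU V hV ζ hζ ⟨_, hζ.symm⟩ ⟨_, TwistCommute.refl ι V⟩
  · exact main ⟨U, hU, hUP⟩ U hU V hV ζ hζ ⟨_, TwistCommute.refl ι U⟩ ⟨_, hζ⟩

end Phase

/-! ### Scalar unitaries -/

section Scalar

variable {m : Type*} [Fintype m] [DecidableEq m]

/-- The scalar unitaries. -/
def scalarHom (m : Type*) [Fintype m] [DecidableEq m] : Circle →* Matrix.unitaryGroup m ℂ where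
  toFun k := ⟨(k : ℂ) • (1 : Matrix m m ℂ), by
    rw [Matrix.mem_unitaryGroup_iff', star_smul, star_one, smul_mul_smul_comm, mul_one]
    have : star (k : ℂ) * (k : ℂ) = 1 := by
      have h := Complex.normSq_eq_conj_mul_self (z := (k : ℂ))
      rw [Circle.normSq_coe] at h
      simpa using h.symm
    rw [this, one_smul]⟩
  map_one' := Subtype.ext (by simp)
  map_mul' k l := Subtype.ext (by simp [smul_smul, mul_comm])

@[simp] theorem coe_scalarHom (k : Circle) :
    ((scalarHom m k : Matrix.unitaryGroup m ℂ) : Matrix m m ℂ) = (k : ℂ) • (1 : Matrix m m ℂ) := rfl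

theorem scalarHom_commute (k : Circle) (U : Matrix.unitaryGroup m ℂ) :
    Commute (scalarHom m k) U :=
  Subtype.ext (by simp)

theorem scalarHom_injective [Nonempty m] : Function.Injective (scalarHom m) := by
  intro k l hkl
  obtain ⟨i⟩ := ‹Nonempty m›
  have := congrFun (congrFun (congrArg Subtype.val hkl) i) i
  simpa [Circle.coe_inj] using this

theorem exists_scalarHom_eq [Nonempty m] {U : Matrix.unitaryGroup m ℂ} {c : ℂ}
    (hU : (U : Matrix m m ℂ) = c • (1 : Matrix m m ℂ)) : ∃ k : Circle, (k : ℂ) = c ∧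
      U = scalarHom m k := by
  obtain ⟨i⟩ := ‹Nonempty m›
  have h := congrFun (congrFun (Matrix.mem_unitaryGroup_iff.mp U.2) i) i
  rw [hU, star_smul, star_one, smul_mul_smul_comm, mul_one] at h
  have h2 : c * star c = 1 := by simpa using h
  have h3 : ‖c‖ = 1 := by
    have h4 := congrArg norm h2
    rw [norm_mul, norm_star, norm_one] at h4
    nlinarith [norm_nonneg c]
  exact ⟨⟨c, mem_sphere_zero_iff_norm.2 h3⟩, rfl, Subtype.ext hU⟩

end Scalar

/-! ### Weyl operators and the symplectic form -/

section Weyl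

variable {p : ℕ} [Fact p.Prime]

local notation "𝒰" => Matrix.unitaryGroup (ZMod p) ℂ
local notation "ι" => scalarHom (ZMod p)
local notation "χ" => ZMod.toCircle

/-- The symplectic form on `ℤ_p²`. -/
def symp (v w : ZMod p × ZMod p) : ZMod p := v.2 * w.1 - v.1 * w.2

/-- The matrix of the Weyl operator `ω ^ (ab / 2) X ^ a Z ^ b`. -/
def weylMatrix (v : ZMod p × ZMod p) : Matrix (ZMod p) (ZMod p) ℂ :=
  Matrix.of fun i j => if i = j + v.1 then (χ (v.2 * j + 2⁻¹ * v.1 * v.2) : ℂ) else 0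

theorem two_ne_zero_of_odd (hp : p ≠ 2) : (2 : ZMod p) ≠ 0 := by
  intro h
  have h2 : ((2 : ℕ) : ZMod p) = 0 := by exact_mod_cast h
  rw [ZMod.natCast_eq_zero_iff] at h2
  exact hp ((Nat.prime_dvd_prime_iff_eq Fact.out Nat.prime_two).1 h2)

/-- The normalisation `ω ^ (ab / 2)` makes the cocycle antisymmetric: exactly half of the
commutation phase. -/
theorem weylMatrix_mul (hp : p ≠ 2) (v w : ZMod p × ZMod p) :
    weylMatrix v * weylMatrix w = (χ (2⁻¹ * symp v w) : ℂ) • weylMatrix (v + w) := by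
  have h2 : (2 : ZMod p) * 2⁻¹ = 1 := mul_inv_cancel₀ (two_ne_zero_of_odd hp)
  ext i j
  simp only [Matrix.mul_apply, weylMatrix, Matrix.of_apply, Matrix.smul_apply, smul_eq_mul]
  rw [Finset.sum_eq_single (j + w.1)]
  · have : i = j + w.1 + v.1 ↔ i = j + (v + w).1 := by
      rw [Prod.fst_add, add_comm v.1, add_assoc]
    simp only [this, if_true]
    split_ifs
    · rw [← Circle.coe_mul, ← Circle.coe_mul, ← AddChar.map_add_eq_mul, ← AddChar.map_add_eq_mul]
      congr 2
      simp only [symp, Prod.fst_add, Prod.snd_add]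
      linear_combination (- v.2 * w.1) * h2
    · simp
  · intro k _ hk
    simp [hk]
  · simp

theorem weylMatrix_zero : weylMatrix (0 : ZMod p × ZMod p) = 1 := by
  ext i j
  simp [weylMatrix, Matrix.one_apply]

theorem star_weylMatrix (hp : p ≠ 2) (v : ZMod p × ZMod p) :
    star (weylMatrix v) = weylMatrix (-v) := by
  have h2 : (2 : ZMod p) * 2⁻¹ = 1 := mul_inv_cancel₀ (two_ne_zero_of_odd hp)
  ext i j
  simp only [Matrix.star_apply, weylMatrix, Matrix.of_apply]
  have : j = i + v.1 ↔ i = j + (-v).1 := by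
    rw [Prod.fst_neg, ← sub_eq_add_neg, eq_sub_iff_add_eq, eq_comm]
  simp only [this]
  split_ifs with h
  · rw [Complex.star_def, ← Circle.coe_inv_eq_conj, ← AddChar.map_neg_eq_inv, h]
    congr 2
    simp only [Prod.fst_neg, Prod.snd_neg]
    linear_combination (- v.1 * v.2) * h2
  · simp

theorem omega_eq : omega p = (χ (1 : ZMod p) : ℂ) := by
  have := ZMod.toCircle_natCast (N := p) 1
  rw [Nat.cast_one] at this
  rw [this, omega]
  simp

theorem omega_pow_val (t : ZMod p) : omega p ^ t.val = (χ t : ℂ) := by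
  rw [omega_eq, ← Circle.coe_pow, ← AddChar.map_nsmul_eq_pow]
  simp

theorem symp_swap (v w : ZMod p × ZMod p) : symp w v = - symp v w := by
  simp only [symp]; ring

theorem symp_ext {v w : ZMod p × ZMod p} (h : ∀ u, symp v u = symp w u) : v = w := by
  have h1 := h (1, 0)
  have h2 := h (0, 1)
  simp [symp] at h1 h2
  exact Prod.ext h2 h1

theorem toCircle_inj {s t : ZMod p} (h : χ s = χ t) : s = t := ZMod.injective_toCircle h

theorem exists_toCircle_eq {ζ : Circle} (h : ζ ^ p = 1) : ∃ t : ZMod p, ζ = χ t := by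
  have hprim : IsPrimitiveRoot (omega p) p := Complex.isPrimitiveRoot_exp p (NeZero.ne p)
  have h' : (ζ : ℂ) ^ p = 1 := by rw [← Circle.coe_pow, h, Circle.coe_one]
  obtain ⟨i, -, hi⟩ := hprim.eq_pow_of_pow_eq_one h'
  refine ⟨i, Circle.ext ?_⟩
  rw [← hi, omega_eq, ← Circle.coe_pow, ← AddChar.map_nsmul_eq_pow]
  simp

variable [Fact (p ≠ 2)]

/-- The Weyl operators. -/
def weyl (v : ZMod p × ZMod p) : 𝒰 := ⟨weylMatrix v, by
  rw [Matrix.mem_unitaryGroup_iff', star_weylMatrix Fact.out,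
    weylMatrix_mul Fact.out, neg_add_cancel, weylMatrix_zero]
  simp [symp, mul_comm]⟩

@[simp] theorem coe_weyl (v : ZMod p × ZMod p) :
    ((weyl v : 𝒰) : Matrix (ZMod p) (ZMod p) ℂ) = weylMatrix v := rfl

theorem weyl_mul (v w : ZMod p × ZMod p) :
    weyl v * weyl w = ι (χ (2⁻¹ * symp v w)) * weyl (v + w) :=
  Subtype.ext (by simp [weylMatrix_mul Fact.out])

theorem weyl_zero : weyl (0 : ZMod p × ZMod p) = 1 := Subtype.ext weylMatrix_zero

theorem weyl_X : weyl ((1, 0) : ZMod p × ZMod p) = pauliX p := by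
  refine Subtype.ext ?_
  ext i j
  simp [weylMatrix, pauliX, matX]

theorem weyl_Z : weyl ((0, 1) : ZMod p × ZMod p) = pauliZ p := by
  refine Subtype.ext ?_
  ext i j
  by_cases h : i = j <;> simp [weylMatrix, pauliZ, matZ, omega_pow_val, h]

theorem weyl_twist (v w : ZMod p × ZMod p) : TwistCommute ι (χ (symp v w)) (weyl v) (weyl w) := by
  have h2 : (2 : ZMod p) * 2⁻¹ = 1 := mul_inv_cancel₀ (two_ne_zero_of_odd Fact.out)
  rw [TwistCommute, weyl_mul, weyl_mul, ← mul_assoc, ← map_mul, ← AddChar.map_add_eq_mul, add_comm w,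
    symp_swap v w]
  congr 3
  linear_combination symp v w * h2

theorem weyl_pow (v : ZMod p × ZMod p) (m : ℕ) : weyl v ^ m = weyl (m • v) := by
  induction m with
  | zero => simp [weyl_zero]
  | succ m ih =>
    have : symp (m • v) v = 0 := by
      simp only [symp, Prod.smul_fst, Prod.smul_snd, smul_mul_assoc]
      rw [mul_comm, sub_self]
    rw [pow_succ, ih, weyl_mul, this, succ_nsmul]
    simp

theorem weyl_pow_prime (v : ZMod p × ZMod p) : weyl v ^ p = 1 := by
  rw [weyl_pow, ← weyl_zero]
  congr 1
  ext <;> simp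

theorem weyl_inv (v : ZMod p × ZMod p) : (weyl v)⁻¹ = weyl (-v) := by
  rw [inv_eq_iff_mul_eq_one, weyl_mul, add_neg_cancel, weyl_zero]
  simp [symp, mul_comm]

/-- The scalar multiples of the Weyl operators, parametrized. -/
def scalarWeyl (x : Circle × (ZMod p × ZMod p)) : 𝒰 := ι x.1 * weyl x.2

theorem scalarWeyl_mul (x y : Circle × (ZMod p × ZMod p)) :
    scalarWeyl x * scalarWeyl y =
      scalarWeyl (x.1 * y.1 * χ (2⁻¹ * symp x.2 y.2), x.2 + y.2) := by
  simp only [scalarWeyl, map_mul]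
  rw [mul_assoc (ι x.1), ← mul_assoc (weyl x.2), ← (scalarHom_commute y.1 (weyl x.2)).eq, mul_assoc,
    weyl_mul]
  simp only [mul_assoc]

theorem scalarWeyl_twist (x y : Circle × (ZMod p × ZMod p)) :
    TwistCommute ι (χ (symp x.2 y.2)) (scalarWeyl x) (scalarWeyl y) := by
  have h1 := (TwistCommute.central_left scalarHom_commute x.1 (scalarWeyl y))
  have h2 := (TwistCommute.central_right scalarHom_commute y.1 (weyl x.2)).mul_right
    scalarHom_commute (weyl_twist x.2 y.2)
  rw [one_mul] at h2
  have h := h1.mul_left scalarHom_commute h2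
  rw [one_mul] at h
  exact h

/-- The commutation phases with all Weyl operators determine the vector, as the symplectic form is
nondegenerate; the scalar can then be cancelled. -/
theorem scalarWeyl_injective : Function.Injective (scalarWeyl (p := p)) := by
  intro x y hxy
  have h : x.2 = y.2 := symp_ext fun u => toCircle_inj
    ((scalarWeyl_twist x (1, u)).unique scalarHom_injective (hxy ▸ scalarWeyl_twist y (1, u)))
  refine Prod.ext ?_ h
  rw [scalarWeyl, scalarWeyl, h] at hxy
  exact scalarHom_injective (mul_right_cancel hxy)

/-- The coordinates of a scalar multiple of a Weyl operator. -/
def weylCoord : 𝒰 → Circle × (ZMod p × ZMod p) := Function.invFun scalarWeyl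

@[simp] theorem weylCoord_scalarWeyl (x : Circle × (ZMod p × ZMod p)) :
    weylCoord (scalarWeyl x) = x :=
  Function.leftInverse_invFun scalarWeyl_injective x

variable (p) in
/-- The group of scalar multiples of Weyl operators. -/
def weylGroup : Subgroup 𝒰 where
  carrier := Set.range scalarWeyl
  one_mem' := ⟨(1, 0), by simp [scalarWeyl, weyl_zero]⟩
  mul_mem' := by
    rintro _ _ ⟨x, rfl⟩ ⟨y, rfl⟩
    exact ⟨_, (scalarWeyl_mul x y).symm⟩
  inv_mem' := by
    rintro _ ⟨x, rfl⟩
    refine ⟨(x.1⁻¹, -x.2), ?_⟩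
    simp only [scalarWeyl]
    rw [mul_inv_rev, weyl_inv, map_inv, ← map_inv, (scalarHom_commute _ _).eq]

theorem scalarWeyl_mem (x : Circle × (ZMod p × ZMod p)) : scalarWeyl x ∈ weylGroup p := ⟨x, rfl⟩

theorem scalarHom_mem (k : Circle) : ι k ∈ weylGroup p := ⟨(k, 0), by simp [scalarWeyl, weyl_zero]⟩

theorem weyl_mem (v : ZMod p × ZMod p) : weyl v ∈ weylGroup p := ⟨(1, v), by simp [scalarWeyl]⟩

/-- The Weyl operators act irreducibly. -/
theorem exists_scalar_of_commute {U : 𝒰} (hX : Commute U (weyl (1, 0)))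
    (hZ : Commute U (weyl (0, 1))) : ∃ k, U = ι k := by
  -- `Z` is diagonal with distinct eigenvalues, so its commutant is diagonal.
  have hdiag : ∀ i j, i ≠ j → (U : Matrix (ZMod p) (ZMod p) ℂ) i j = 0 := by
    intro i j hij
    have h := congrFun (congrFun (congrArg Subtype.val hZ.eq) i) j
    have hz : weylMatrix ((0, 1) : ZMod p × ZMod p) = Matrix.diagonal fun q => (χ q : ℂ) := by
      ext i j
      by_cases h : i = j <;> simp [weylMatrix, h]
    simp only [Submonoid.coe_mul, coe_weyl, hz, Matrix.mul_diagonal, Matrix.diagonal_mul] at h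
    have hne : (χ j : ℂ) - χ i ≠ 0 := by
      rw [sub_ne_zero, Ne, Circle.coe_inj]
      exact fun hcon => hij (toCircle_inj hcon).symm
    refine (mul_eq_zero.1 ?_).resolve_right hne
    rw [mul_sub, h]; ring
  -- Commuting with the cyclic shift `X` makes the diagonal constant.
  have hconst : ∀ i, (U : Matrix (ZMod p) (ZMod p) ℂ) (i + 1) (i + 1) =
      (U : Matrix (ZMod p) (ZMod p) ℂ) i i := by
    intro i
    have h := congrFun (congrFun (congrArg Subtype.val hX.eq) (i + 1)) i
    simpa [Matrix.mul_apply, weylMatrix] using h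
  have hconst' : ∀ i : ℕ, (U : Matrix (ZMod p) (ZMod p) ℂ) i i =
      (U : Matrix (ZMod p) (ZMod p) ℂ) 0 0 := by
    intro i
    induction i with
    | zero => simp
    | succ i ih => rw [Nat.cast_succ, hconst, ih]
  obtain ⟨k, -, hk⟩ := exists_scalarHom_eq (U := U)
    (c := (U : Matrix (ZMod p) (ZMod p) ℂ) 0 0) (by
      ext i j
      by_cases h : i = j
      · subst h
        simpa using hconst' i.val
      · simp [hdiag i j h, h])
  exact ⟨k, hk⟩

end Weyl

/-! ### Commuting nilpotent maps in dimension two -/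

/-- On a two-dimensional space a nonzero nilpotent map spans the nilpotent maps that commute with
it. -/
theorem exists_smul_eq_of_nilpotent {K V : Type*} [Field K] [AddCommGroup V] [Module K V]
    (hV : Module.finrank K V = 2) {f g : Module.End K V} (hf : IsNilpotent f) (hg : IsNilpotent g)
    (hfg : Commute f g) (hf0 : f ≠ 0) : f ^ 2 = 0 ∧ ∃ t : K, g = t • f := by
  have : FiniteDimensional K V := FiniteDimensional.of_finrank_pos (by omega)
  have hsq : ∀ f : Module.End K V, IsNilpotent f → f ^ 2 = 0 := by
    intro f hf
    have h := LinearMap.aeval_self_charpoly f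
    rw [hf.charpoly_eq_X_pow_finrank, hV] at h
    simpa using h
  refine ⟨hsq f hf, ?_⟩
  obtain ⟨v, hv⟩ : ∃ v, f v ≠ 0 := by
    by_contra! hcon
    exact hf0 (LinearMap.ext hcon)
  have hff : ∀ u, f (f u) = 0 := fun u => by
    have := congrFun (congrArg DFunLike.coe (hsq f hf)) u
    simpa [sq] using this
  have hgg : ∀ u, g (g u) = 0 := fun u => by
    have := congrFun (congrArg DFunLike.coe (hsq g hg)) u
    simpa [sq] using this
  have hcomm : ∀ u, g (f u) = f (g u) := fun u => (congrFun (congrArg DFunLike.coe hfg.eq) u).symm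
  -- In the basis `v, f v`, the map `g` is determined by `g v`, because `g (f v) = f (g v)`.
  have hli : LinearIndependent K ![v, f v] := by
    rw [LinearIndependent.pair_iff]
    intro a b hab
    have h1 : a • f v = 0 := by simpa [hff] using congrArg f hab
    have ha : a = 0 := (smul_eq_zero.1 h1).resolve_right hv
    subst ha
    rw [zero_smul, zero_add] at hab
    exact ⟨rfl, (smul_eq_zero.1 hab).resolve_right hv⟩
  let B := basisOfLinearIndependentOfCardEqFinrank hli (by simp [hV])
  have hB : ⇑B = ![v, f v] := coe_basisOfLinearIndependentOfCardEqFinrank hli (by simp [hV])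
  obtain ⟨a, b, hab⟩ : ∃ a b : K, g v = a • v + b • f v := by
    refine ⟨B.repr (g v) 0, B.repr (g v) 1, ?_⟩
    conv_lhs => rw [← B.sum_repr (g v)]
    simp [Fin.sum_univ_two, hB]
  have hgf : g (f v) = a • f v := by simp [hcomm, hab, hff]
  -- `a` is an eigenvalue of the nilpotent map `g`, with eigenvector `f v`.
  have ha : a = 0 := by
    have h := hgg (f v)
    rw [hgf, map_smul, hgf, smul_smul] at h
    simpa using (smul_eq_zero.1 h).resolve_right hv
  subst ha
  refine ⟨b, B.ext fun i => ?_⟩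
  rw [hB]
  fin_cases i
  · simpa using hab
  · simpa [hff] using hgf

/-! ### Action of the Clifford group on the phase space `ℤ_p²` -/

section Action

variable {p : ℕ} [Fact p.Prime]

local notation "𝒰" => Matrix.unitaryGroup (ZMod p) ℂ
local notation "ι" => scalarHom (ZMod p)
local notation "χ" => ZMod.toCircle

theorem conj_scalarHom_mul (U T : 𝒰) (k : Circle) : U * (ι k * T) * U⁻¹ = ι k * (U * T * U⁻¹) := by
  rw [← mul_assoc U, ← (scalarHom_commute k U).eq]
  group

theorem TwistCommute.exists_mul_pow {ζ : Circle} {U V : 𝒰} (h : TwistCommute ι ζ U V) (n : ℕ) :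
    ∃ k, (U * V) ^ n = ι k * (U ^ n * V ^ n) := by
  induction n with
  | zero => exact ⟨1, by simp⟩
  | succ n ih =>
    obtain ⟨k, hk⟩ := ih
    have h2 := (h.zpow_right scalarHom_commute n).symm
    rw [zpow_natCast V, TwistCommute] at h2
    refine ⟨k * (ζ ^ (n : ℤ))⁻¹, ?_⟩
    rw [pow_succ, hk, pow_succ, pow_succ]
    calc ι k * (U ^ n * V ^ n) * (U * V) = ι k * (U ^ n * (V ^ n * U) * V) := by
          simp only [mul_assoc]
      _ = ι k * ((U ^ n * ι (ζ ^ (n : ℤ))⁻¹) * (U * V ^ n * V)) := by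
          rw [h2]; simp only [mul_assoc]
      _ = _ := by rw [← (scalarHom_commute _ (U ^ n)).eq, map_mul]; simp only [mul_assoc]

variable [Fact (p ≠ 2)]

theorem weylCoord_mul_weyl (k : Circle) (v : ZMod p × ZMod p) :
    (weylCoord (ι k * weyl v)).2 = v :=
  congrArg Prod.snd (weylCoord_scalarWeyl (k, v))

variable (p) in
/-- The normalizer of the group of scalar multiples of Weyl operators. -/
def weylNormalizer : Subgroup 𝒰 := Subgroup.normalizer (weylGroup p : Set 𝒰)

/-- The vector `w` such that `U` conjugates the Weyl operator of `v` into that of `w`, up to a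
scalar. -/
def conjVec (U : 𝒰) (v : ZMod p × ZMod p) : ZMod p × ZMod p := (weylCoord (U * weyl v * U⁻¹)).2

theorem conjVec_eq {U : 𝒰} {v w : ZMod p × ZMod p} {k : Circle}
    (h : U * weyl v * U⁻¹ = ι k * weyl w) : conjVec U v = w := by
  rw [conjVec, h, weylCoord_mul_weyl]

theorem exists_conj_weyl {U : 𝒰} (hU : U ∈ weylNormalizer p) (v : ZMod p × ZMod p) :
    ∃ k, U * weyl v * U⁻¹ = ι k * weyl (conjVec U v) := by
  obtain ⟨x, hx⟩ := (Subgroup.mem_normalizer_iff.1 hU (weyl v)).1 (weyl_mem v)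
  exact ⟨x.1, by rw [conjVec_eq hx.symm, ← hx, scalarWeyl]⟩

/-- Up to scalars, addition of vectors is multiplication of Weyl operators, which conjugation
respects. -/
theorem conjVec_add {U : 𝒰} (hU : U ∈ weylNormalizer p) (v w : ZMod p × ZMod p) :
    conjVec U (v + w) = conjVec U v + conjVec U w := by
  obtain ⟨k, hk⟩ := exists_conj_weyl hU v
  obtain ⟨l, hl⟩ := exists_conj_weyl hU w
  have h1 : weyl (v + w) = ι (χ (2⁻¹ * symp v w))⁻¹ * (weyl v * weyl w) := by
    rw [weyl_mul, ← mul_assoc, ← map_mul, inv_mul_cancel, map_one, one_mul]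
  have h2 : U * (weyl v * weyl w) * U⁻¹ = (U * weyl v * U⁻¹) * (U * weyl w * U⁻¹) := by group
  have h3 := scalarWeyl_mul (k, conjVec U v) (l, conjVec U w)
  simp only [scalarWeyl] at h3
  refine conjVec_eq (k := (χ (2⁻¹ * symp v w))⁻¹ *
    (k * l * χ (2⁻¹ * symp (conjVec U v) (conjVec U w)))) ?_
  rw [h1, conj_scalarHom_mul, h2, hk, hl, h3, ← mul_assoc, ← map_mul]

theorem conjVec_mul (U : 𝒰) {V : 𝒰} (hU : U ∈ weylNormalizer p) (hV : V ∈ weylNormalizer p)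
    (v : ZMod p × ZMod p) : conjVec (U * V) v = conjVec U (conjVec V v) := by
  obtain ⟨k, hk⟩ := exists_conj_weyl hV v
  obtain ⟨l, hl⟩ := exists_conj_weyl hU (conjVec V v)
  have h : U * V * weyl v * (U * V)⁻¹ = U * (V * weyl v * V⁻¹) * U⁻¹ := by group
  refine conjVec_eq (k := k * l) ?_
  rw [h, hk, conj_scalarHom_mul, hl, ← mul_assoc, ← map_mul]

theorem conjVec_one (v : ZMod p × ZMod p) : conjVec 1 v = v :=
  conjVec_eq (k := 1) (by simp)

variable (p) in
/-- The action of the normalizer on the phase space `ℤ_p²`. -/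
def weylAct : weylNormalizer p →* Module.End (ZMod p) (ZMod p × ZMod p) where
  toFun U := AddMonoidHom.toZModLinearMap p (AddMonoidHom.mk' (conjVec (U : 𝒰)) (conjVec_add U.2))
  map_one' := LinearMap.ext conjVec_one
  map_mul' U V := LinearMap.ext (conjVec_mul (U : 𝒰) U.2 V.2)

theorem weylAct_apply (U : weylNormalizer p) (v : ZMod p × ZMod p) :
    weylAct p U v = conjVec (U : 𝒰) v := rfl

theorem weylAct_eq {U : weylNormalizer p} {v w : ZMod p × ZMod p} {k : Circle}
    (h : (U : 𝒰) * weyl v * (U : 𝒰)⁻¹ = ι k * weyl w) : weylAct p U v = w := conjVec_eq h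

theorem scalarHom_mem_weylNormalizer (k : Circle) : ι k ∈ weylNormalizer p :=
  Subgroup.le_normalizer (scalarHom_mem k)

theorem weylAct_of_mem {U : weylNormalizer p} (hU : (U : 𝒰) ∈ weylGroup p) : weylAct p U = 1 := by
  obtain ⟨x, hx⟩ := hU
  refine LinearMap.ext fun v => ?_
  refine weylAct_eq (k := χ (symp x.2 v)) ?_
  have h := scalarWeyl_twist x (1, v)
  rw [TwistCommute.iff_conj] at h
  rw [← hx]
  simpa [scalarWeyl] using h

/-- With trivial action, `U` commutes with `X` and `Z` up to powers of `ω`. A suitable Weyl operator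
cancels both phases, and irreducibility makes the product scalar. -/
theorem mem_of_weylAct {U : weylNormalizer p} (hU : weylAct p U = 1) : (U : 𝒰) ∈ weylGroup p := by
  have key : ∀ v, ∃ a : ZMod p, TwistCommute ι (χ a) (U : 𝒰) (weyl v) := by
    intro v
    obtain ⟨k, hk⟩ := exists_conj_weyl U.2 v
    rw [← weylAct_apply, hU] at hk
    have h1 : TwistCommute ι k (U : 𝒰) (weyl v) := TwistCommute.iff_conj.2 hk
    obtain ⟨a, rfl⟩ := exists_toCircle_eq (h1.pow_eq_one scalarHom_commute scalarHom_injective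
      (k := 1) (by rw [weyl_pow_prime, map_one]))
    exact ⟨a, h1⟩
  obtain ⟨a, ha⟩ := key (1, 0)
  obtain ⟨b, hb⟩ := key (0, 1)
  -- The vector `(b, -a)` pairs to `-a` with `(1, 0)` and to `-b` with `(0, 1)`.
  have h1 := (weyl_twist (b, -a) ((1, 0) : ZMod p × ZMod p)).mul_left scalarHom_commute ha
  have h2 := (weyl_twist (b, -a) ((0, 1) : ZMod p × ZMod p)).mul_left scalarHom_commute hb
  rw [← AddChar.map_add_eq_mul] at h1 h2
  simp only [symp, mul_one, mul_zero, sub_zero, zero_sub, neg_add_cancel, AddChar.map_zero_eq_one,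
    TwistCommute.one_iff] at h1 h2
  obtain ⟨k, hk⟩ := exists_scalar_of_commute h1 h2
  rw [eq_inv_mul_iff_mul_eq.2 hk]
  exact mul_mem (inv_mem (weyl_mem _)) (scalarHom_mem k)

variable (p) in
/-- The elements of order `p` modulo scalars that normalize the Weyl operators. -/
def torsionSet : Set 𝒰 := {U | U ∈ weylNormalizer p ∧ ∃ d, U ^ p = ι d}

theorem weylGroup_le : ((weylGroup p : Subgroup 𝒰) : Set 𝒰) ⊆ torsionSet p := by
  rintro _ ⟨x, rfl⟩
  refine ⟨Subgroup.le_normalizer (scalarWeyl_mem x), x.1 ^ p, ?_⟩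
  rw [scalarWeyl, (scalarHom_commute _ _).mul_pow, weyl_pow_prime, mul_one, map_pow]

theorem torsionSet_mul {ζ : Circle} {U V : 𝒰} (hU : U ∈ torsionSet p) (hV : V ∈ torsionSet p)
    (h : TwistCommute ι ζ U V) : U * V ∈ torsionSet p := by
  obtain ⟨hU, d, hd⟩ := hU
  obtain ⟨hV, e, he⟩ := hV
  obtain ⟨k, hk⟩ := h.exists_mul_pow p
  exact ⟨mul_mem hU hV, k * (d * e), by rw [hk, hd, he, map_mul, map_mul]⟩

theorem weylAct_commute {ζ : Circle} {U V : weylNormalizer p}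
    (h : TwistCommute ι ζ (U : 𝒰) (V : 𝒰)) : Commute (weylAct p U) (weylAct p V) := by
  have h1 : U * V = ⟨ι ζ, scalarHom_mem_weylNormalizer ζ⟩ * (V * U) := Subtype.ext h
  have h2 := congrArg (weylAct p) h1
  rwa [map_mul, map_mul, map_mul,
    weylAct_of_mem (U := ⟨ι ζ, scalarHom_mem_weylNormalizer ζ⟩) (scalarHom_mem ζ), one_mul] at h2

/-- In characteristic `p`, `(T - 1) ^ p = T ^ p - 1`, and `T ^ p = 1` because scalars act trivially.
-/
theorem weylAct_sub_one_nilpotent {U : weylNormalizer p} (hU : (U : 𝒰) ∈ torsionSet p) :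
    IsNilpotent (weylAct p U - 1) := by
  obtain ⟨-, d, hd⟩ := hU
  have : CharP (Module.End (ZMod p) (ZMod p × ZMod p)) p :=
    charP_of_injective_algebraMap (algebraMap (ZMod p) _).injective p
  refine ⟨p, ?_⟩
  rw [sub_pow_char_of_commute (p := p) (h := Commute.one_right _), one_pow, ← map_pow, weylAct_of_mem,
    sub_self]
  rw [Subgroup.coe_pow, hd]
  exact scalarHom_mem d

/-- The actions of `U` and `V` are commuting unipotents `1 + N` and `1 + t N` with `N ^ 2 = 0`, so
`V` acts as `U ^ t` does. Elements with the same action differ by a Weyl operator up to a scalar. -/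
theorem exists_eq_mul_zpow {ζ : Circle} {U V : 𝒰} (hU : U ∈ torsionSet p) (hUP : U ∉ weylGroup p)
    (hV : V ∈ torsionSet p) (h : TwistCommute ι ζ U V) :
    ∃ Q ∈ weylGroup p, ∃ m : ℤ, V = Q * U ^ m := by
  let U' : weylNormalizer p := ⟨U, hU.1⟩
  let V' : weylNormalizer p := ⟨V, hV.1⟩
  have hc : Commute (weylAct p U' - 1) (weylAct p V' - 1) :=
    (((weylAct_commute (U := U') (V := V') h).sub_left (Commute.one_left _)).sub_right
      (Commute.one_right _))
  obtain ⟨hsq, t, ht⟩ := exists_smul_eq_of_nilpotent (by simp)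
    (weylAct_sub_one_nilpotent (U := U') hU) (weylAct_sub_one_nilpotent (U := V') hV) hc
    (fun hcon => hUP (mem_of_weylAct (U := U') (sub_eq_zero.1 hcon)))
  have hpow : ∀ m : ℕ, weylAct p U' ^ m = 1 + (m : ZMod p) • (weylAct p U' - 1) := by
    intro m
    induction m with
    | zero => simp
    | succ m ih =>
      have e : (weylAct p U' - 1) * (weylAct p U' - 1) = 0 := by rw [← sq, hsq]
      have e2 : weylAct p U' = 1 + (weylAct p U' - 1) := by abel
      rw [pow_succ, ih]
      nth_rewrite 2 [e2]
      rw [mul_add, mul_one, add_mul, one_mul, smul_mul_assoc, e, smul_zero, add_zero,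
        Nat.cast_succ, add_smul, one_smul, add_assoc]
  have hV' : weylAct p V' = weylAct p (U' ^ t.val) := by
    rw [map_pow, hpow, ZMod.natCast_zmod_val, ← ht]
    abel
  refine ⟨V * (U ^ (t.val : ℤ))⁻¹, ?_, t.val, by simp⟩
  rw [zpow_natCast]
  refine mem_of_weylAct (U := V' * (U' ^ t.val)⁻¹) ?_
  rw [map_mul, hV', ← map_mul, mul_inv_cancel, map_one]

/-- The vectors of `Q` and `Q'` are fixed by the action of `U`. If `Q` and `Q'` did not commute,
these vectors would span the plane and `U` would act trivially. -/
theorem weylGroup_commute {η η' : Circle} {U Q Q' : 𝒰} (hU : U ∈ torsionSet p)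
    (hUP : U ∉ weylGroup p) (hQ : Q ∈ weylGroup p) (hQ' : Q' ∈ weylGroup p)
    (h : TwistCommute ι η Q U) (h' : TwistCommute ι η' Q' U) : Commute Q Q' := by
  obtain ⟨x, rfl⟩ := hQ
  obtain ⟨y, rfl⟩ := hQ'
  let U' : weylNormalizer p := ⟨U, hU.1⟩
  have key : ∀ (x : Circle × (ZMod p × ZMod p)) (η : Circle), TwistCommute ι η (scalarWeyl x) U →
      weylAct p U' x.2 = x.2 := by
    intro x η hx
    have h1 := (TwistCommute.central_right scalarHom_commute x.1⁻¹ U).mul_right scalarHom_commute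
      hx.symm
    rw [scalarWeyl, map_inv, inv_mul_cancel_left, TwistCommute.iff_conj] at h1
    exact weylAct_eq (U := U') h1
  have hx := key x η h
  have hy := key y η' h'
  by_cases h0 : symp x.2 y.2 = 0
  · have := scalarWeyl_twist x y
    rwa [h0, AddChar.map_zero_eq_one, TwistCommute.one_iff] at this
  · refine absurd (mem_of_weylAct (U := U') ?_) hUP
    refine LinearMap.ext fun v => ?_
    -- Cramer's rule, with the symplectic form as determinant.
    have hv : v = ((symp x.2 y.2)⁻¹ * symp v y.2) • x.2 - ((symp x.2 y.2)⁻¹ * symp v x.2) • y.2 := by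
      rw [mul_smul, mul_smul, ← smul_sub, eq_inv_smul_iff₀ h0]
      ext <;> simp [symp] <;> ring
    rw [hv]
    simp [hx, hy]

/-- The phase function on the elements of order `p` modulo scalars of the normalizer. -/
theorem exists_phase_torsionSet : ∃ φ : 𝒰 → Circle, (∀ k, φ (ι k) = k) ∧
    ∀ U ∈ torsionSet p, ∀ V ∈ torsionSet p, ∀ ζ, TwistCommute ι ζ U V →
      φ (U * V) = ζ ^ ((p + 1) / 2) * φ U * φ V := by
  have hp : p.Prime := Fact.out
  have h2h : (p + 1) / 2 * 2 = p + 1 :=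
    Nat.div_mul_cancel (hp.eq_two_or_odd'.resolve_left Fact.out).add_one.two_dvd
  have h2h' : (((p + 1) / 2 : ℕ) : ZMod p) = 2⁻¹ := by
    have h1 := congrArg (Nat.cast (R := ZMod p)) h2h
    rw [Nat.cast_mul, Nat.cast_add p 1, Nat.cast_ofNat, CharP.cast_eq_zero (ZMod p) p, Nat.cast_one,
      zero_add] at h1
    exact eq_inv_of_mul_eq_one_left h1
  refine exists_phase (P := weylGroup p) (ψ := fun U => (weylCoord U).1) (E := torsionSet p) hp
    scalarHom_commute scalarHom_injective ?_ ?_ scalarHom_mem ?_ ?_ ?_ (fun U hU => hU.2)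
    (fun U hU V hV ζ h => torsionSet_mul hU hV h)
    (fun U hU hUP V hV ζ h => exists_eq_mul_zpow hU hUP hV h)
    (fun U hU hUP Q hQ Q' hQ' η η' h h' => weylGroup_commute hU hUP hQ hQ' h h')
  · intro k
    -- A `p`-th root on the circle, by dividing the argument.
    refine ⟨Circle.exp (Complex.arg k / p), ?_⟩
    rw [← Circle.exp_natCast_mul, mul_div_cancel₀ _ (Nat.cast_ne_zero.2 hp.ne_zero),
      Circle.exp_arg]
  · intro η hη
    rw [← pow_mul, h2h, pow_succ, hη, one_mul]
  · intro k
    have : ι k = scalarWeyl (k, 0) := by simp [scalarWeyl, weyl_zero]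
    rw [this, weylCoord_scalarWeyl]
  · rintro _ ⟨x, rfl⟩ _ ⟨y, rfl⟩ ζ h
    rw [h.unique scalarHom_injective (scalarWeyl_twist x y), scalarWeyl_mul]
    simp only [weylCoord_scalarWeyl]
    rw [← AddChar.map_nsmul_eq_pow, nsmul_eq_mul, h2h', mul_assoc _ x.1, mul_comm]
  · rintro _ ⟨x, rfl⟩ _ ⟨y, rfl⟩
    exact ⟨_, scalarWeyl_twist x y⟩

theorem pauliGroup_le : pauliGroup p ≤ weylGroup p := by
  rw [pauliGroup, Subgroup.closure_le]
  rintro _ (rfl | rfl)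
  · exact weyl_X (p := p) ▸ weyl_mem _
  · exact weyl_Z (p := p) ▸ weyl_mem _

/-- The Weyl group with scalars is generated by `X`, `Z` and the scalars, so conjugation need only
be checked on `X` and `Z`. -/
theorem cliffordGroup_le : cliffordGroup p ≤ weylNormalizer p := by
  have key : ∀ U ∈ cliffordGroup p, ∀ Q ∈ weylGroup p, U * Q * U⁻¹ ∈ weylGroup p := by
    rintro U hU _ ⟨x, rfl⟩
    have hgen : ∀ Q ∈ pauliGroup p, U * Q * U⁻¹ ∈ weylGroup p := fun Q hQ =>
      pauliGroup_le ((Subgroup.mem_normalizer_iff.1 hU Q).1 hQ)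
    have hX := hgen (weyl (1, 0)) (weyl_X (p := p) ▸ Subgroup.subset_closure (by simp))
    have hZ := hgen (weyl (0, 1)) (weyl_Z (p := p) ▸ Subgroup.subset_closure (by simp))
    have hx : scalarWeyl x = ι (x.1 * (χ (2⁻¹ * symp (x.2.1, 0) (0, x.2.2)))⁻¹) *
        (weyl (1, 0) ^ x.2.1.val * weyl (0, 1) ^ x.2.2.val) := by
      rw [weyl_pow, weyl_pow]
      have e1 : x.2.1.val • ((1, 0) : ZMod p × ZMod p) = (x.2.1, 0) := by ext <;> simp
      have e2 : x.2.2.val • ((0, 1) : ZMod p × ZMod p) = (0, x.2.2) := by ext <;> simp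
      rw [e1, e2, weyl_mul, ← mul_assoc, ← map_mul, inv_mul_cancel_right, scalarWeyl]
      simp
    have hconj : U * scalarWeyl x * U⁻¹ =
        ι (x.1 * (χ (2⁻¹ * symp (x.2.1, 0) (0, x.2.2)))⁻¹) *
          ((U * weyl (1, 0) * U⁻¹) ^ x.2.1.val * (U * weyl (0, 1) * U⁻¹) ^ x.2.2.val) := by
      rw [hx, ← mul_assoc U, ← (scalarHom_commute _ U).eq, conj_pow, conj_pow]
      group
    rw [hconj]
    exact mul_mem (scalarHom_mem _) (mul_mem (pow_mem hX _) (pow_mem hZ _))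
  intro U hU
  refine Subgroup.mem_normalizer_iff.2 fun Q => ⟨key U hU Q, fun hQ => ?_⟩
  have := key U⁻¹ (inv_mem hU) _ hQ
  simpa [mul_assoc] using this

end Action

/-! ### Tensor products and the phase function on local Clifford elements -/

section Tensor

variable {p n : ℕ}

/-- Freezing all other indices at `0` exhibits `M i` as a scalar matrix, up to the factor `∏ M k 0
0`, which is nonzero because `c` is. -/
theorem exists_scalar_of_tensorMatrix {M : Fin n → Matrix (ZMod p) (ZMod p) ℂ} {c : ℂ}
    (hc : c ≠ 0) (h : tensorMatrix M = c • (1 : Matrix (Fin n → ZMod p) (Fin n → ZMod p) ℂ))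
    (i : Fin n) : M i = M i 0 0 • (1 : Matrix (ZMod p) (ZMod p) ℂ) := by
  have hent : ∀ u v : Fin n → ZMod p, ∏ k, M k (u k) (v k) = c * if u = v then 1 else 0 := by
    intro u v
    have := congrFun (congrFun h u) v
    simpa [tensorMatrix, Matrix.one_apply] using this
  have hsplit : ∀ a b : ZMod p, M i a b * ∏ k ∈ Finset.univ.erase i, M k 0 0 =
      c * if a = b then 1 else 0 := by
    intro a b
    have h1 := hent (Function.update (0 : Fin n → ZMod p) i a)
      (Function.update (0 : Fin n → ZMod p) i b)
    rw [← Finset.mul_prod_erase _ _ (Finset.mem_univ i)] at h1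
    have h2 : (Function.update (0 : Fin n → ZMod p) i a = Function.update (0 : Fin n → ZMod p) i b) ↔
        a = b :=
      (Function.update_injective _ i).eq_iff
    simp only [Function.update_self, h2] at h1
    rw [← h1]
    congr 1
    refine Finset.prod_congr rfl fun k hk => ?_
    simp [Function.update_of_ne (Finset.ne_of_mem_erase hk)]
  have hne : ∏ k ∈ Finset.univ.erase i, M k 0 0 ≠ 0 := by
    intro h0
    have := hsplit 0 0
    rw [h0] at this
    simp [hc.symm] at this
  ext a b
  refine mul_right_cancel₀ hne ?_
  rw [hsplit, Matrix.smul_apply, smul_eq_mul, Matrix.one_apply, mul_right_comm, hsplit]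
  simp

variable [Fact p.Prime]

local notation "𝒰" => Matrix.unitaryGroup (ZMod p) ℂ
local notation "ι" => scalarHom (ZMod p)
local notation "ιₙ" => scalarHom (Fin n → ZMod p)
local notation "χ" => ZMod.toCircle

theorem tensorHom_scalarHom (l : Fin n → Circle) :
    tensorHom p n (fun i => ι (l i)) = ιₙ (∏ i, l i) := by
  refine Subtype.ext ?_
  change tensorMatrix (fun i => ((ι (l i) : 𝒰) : Matrix (ZMod p) (ZMod p) ℂ)) =
    ((∏ i, l i : Circle) : ℂ) • (1 : Matrix _ _ ℂ)
  rw [← tensorMatrix_one p n]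
  ext u v
  have : ((∏ i, l i : Circle) : ℂ) = ∏ i, (l i : ℂ) := map_prod Circle.coeHom _ _
  simp only [tensorMatrix, Matrix.of_apply, coe_scalarHom, Matrix.smul_apply, smul_eq_mul,
    Finset.prod_mul_distrib, this]

theorem exists_scalar_of_tensorHom {U : Fin n → 𝒰} {k : Circle}
    (h : tensorHom p n U = ιₙ k) : ∃ l : Fin n → Circle, (∀ i, U i = ι (l i)) ∧ ∏ i, l i = k := by
  have h1 : tensorMatrix (fun i => (U i : Matrix (ZMod p) (ZMod p) ℂ)) = (k : ℂ) • 1 :=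
    congrArg Subtype.val h
  choose l _ hl using fun i => exists_scalarHom_eq (exists_scalar_of_tensorMatrix k.coe_ne_zero h1 i)
  refine ⟨l, hl, scalarHom_injective (m := Fin n → ZMod p) ?_⟩
  rw [← tensorHom_scalarHom, ← h]
  exact congrArg _ (funext fun i => (hl i).symm)

theorem exists_prod_eq (hn : 1 ≤ n) (k : Circle) : ∃ l : Fin n → Circle, ∏ i, l i = k :=
  ⟨Pi.mulSingle ⟨0, hn⟩ k, by simp⟩

theorem scalarHom_mem_localClifford (hn : 1 ≤ n) (k : Circle) : ιₙ k ∈ localClifford p n := by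
  obtain ⟨l, rfl⟩ := exists_prod_eq hn k
  refine ⟨fun i => ι (l i), fun i _ => ?_, tensorHom_scalarHom l⟩
  refine Subgroup.mem_normalizer_iff.2 fun U => ?_
  rw [(scalarHom_commute (l i) U).eq, mul_inv_cancel_right]

/-- The tensor product of the commutators of the factors is `1`, so each commutator is scalar and
the scalars multiply to `1`. -/
theorem exists_twist_of_commute {U V : Fin n → 𝒰}
    (h : Commute (tensorHom p n U) (tensorHom p n V)) :
    ∃ l : Fin n → Circle, (∀ i, TwistCommute ι (l i) (U i) (V i)) ∧ ∏ i, l i = 1 := by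
  have h1 : tensorHom p n (U * V * (V * U)⁻¹) = ιₙ 1 := by
    rw [map_mul, map_inv, map_mul, map_mul, h.eq, mul_inv_cancel, map_one]
  obtain ⟨l, hl, hl1⟩ := exists_scalar_of_tensorHom h1
  exact ⟨l, fun i => mul_inv_eq_iff_eq_mul.1 (hl i), hl1⟩

variable [Fact (p ≠ 2)]

variable (p n) in
/-- The tensor products of elements of order `p` modulo scalars. -/
def tensorTorsionSet : Set (Matrix.unitaryGroup (Fin n → ZMod p) ℂ) :=
  {x | ∃ U : Fin n → 𝒰, (∀ i, U i ∈ torsionSet p) ∧ tensorHom p n U = x}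

/-- From `x ^ p = 1` one learns only that each factor has scalar `p`-th power, which is why
`torsionSet` allows an arbitrary scalar. -/
theorem mem_tensorTorsionSet {x : Matrix.unitaryGroup (Fin n → ZMod p) ℂ}
    (hx : x ∈ localClifford p n) (hxp : x ^ p = 1) : x ∈ tensorTorsionSet p n := by
  obtain ⟨U, hU, rfl⟩ := hx
  rw [← map_pow, ← map_one ιₙ] at hxp
  obtain ⟨l, hl, -⟩ := exists_scalar_of_tensorHom hxp
  exact ⟨U, fun i => ⟨cliffordGroup_le (hU i trivial), l i, hl i⟩, rfl⟩

theorem scalarHom_mem_torsionSet (k : Circle) : ι k ∈ torsionSet p := weylGroup_le (scalarHom_mem k)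

/-- The phase function on the local Clifford elements of order `p`. -/
theorem exists_phase_tensorTorsionSet (hn : 1 ≤ n) :
    ∃ F : Matrix.unitaryGroup (Fin n → ZMod p) ℂ → Circle,
      (∀ k, ιₙ k ∈ tensorTorsionSet p n ∧ F (ιₙ k) = k) ∧
      ∀ x ∈ tensorTorsionSet p n, ∀ y ∈ tensorTorsionSet p n, Commute x y →
        x * y ∈ tensorTorsionSet p n ∧ F (x * y) = F x * F y := by
  classical
  obtain ⟨φ, hφι, hφ⟩ := exists_phase_torsionSet (p := p)
  let F : Matrix.unitaryGroup (Fin n → ZMod p) ℂ → Circle := fun x =>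
    if h : x ∈ tensorTorsionSet p n then ∏ i, φ (h.choose i) else 1
  have hF : ∀ U : Fin n → 𝒰, (∀ i, U i ∈ torsionSet p) → F (tensorHom p n U) = ∏ i, φ (U i) := by
    intro U hU
    have h : tensorHom p n U ∈ tensorTorsionSet p n := ⟨U, hU, rfl⟩
    have e : F (tensorHom p n U) = ∏ i, φ (h.choose i) := dif_pos h
    obtain ⟨hV, hVU⟩ := h.choose_spec
    rw [e]
    set V := h.choose
    -- Independence of the chosen factorisation: two of them differ by scalars with product `1`, and
    -- `φ` is homogeneous under scalars.
    have h1 : tensorHom p n (V * U⁻¹) = ιₙ 1 := by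
      rw [map_mul, map_inv, hVU, mul_inv_cancel, map_one]
    obtain ⟨l, hl, hl1⟩ := exists_scalar_of_tensorHom h1
    have h2 : ∀ i, φ (V i) = l i * φ (U i) := by
      intro i
      have h3 : V i = ι (l i) * U i := mul_inv_eq_iff_eq_mul.1 (hl i)
      rw [h3, hφ _ (scalarHom_mem_torsionSet _) _ (hU i) 1
        (TwistCommute.central_left scalarHom_commute _ _), hφι, one_pow, one_mul]
    simp only [h2, Finset.prod_mul_distrib, hl1, one_mul]
  refine ⟨F, fun k => ?_, ?_⟩
  · obtain ⟨l, rfl⟩ := exists_prod_eq hn k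
    rw [← tensorHom_scalarHom]
    exact ⟨⟨_, fun i => scalarHom_mem_torsionSet _, rfl⟩,
      by rw [hF _ fun i => scalarHom_mem_torsionSet _]; simp only [hφι]⟩
  · rintro _ ⟨U, hU, rfl⟩ _ ⟨V, hV, rfl⟩ hc
    obtain ⟨l, hl, hl1⟩ := exists_twist_of_commute hc
    have hUV : ∀ i, (U * V) i ∈ torsionSet p := fun i => torsionSet_mul (hU i) (hV i) (hl i)
    rw [← map_mul]
    refine ⟨⟨_, hUV, rfl⟩, ?_⟩
    rw [hF _ hUV, hF _ hU, hF _ hV]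
    have h2 : ∀ i, φ ((U * V) i) = l i ^ ((p + 1) / 2) * φ (U i) * φ (V i) := fun i =>
      hφ _ (hU i) _ (hV i) _ (hl i)
    simp only [h2, Finset.prod_mul_distrib, Finset.prod_pow, hl1, one_pow, one_mul]

end Tensor

/-! ### Functions multiplicative on commuting pairs -/

section PartialHom

variable {G K : Type*} [Group G] [CommGroup K] {T : Set G} {F : G → K}

theorem map_pow_of_commute (h1 : 1 ∈ T ∧ F 1 = 1)
    (hmul : ∀ x ∈ T, ∀ y ∈ T, Commute x y → x * y ∈ T ∧ F (x * y) = F x * F y) {x : G} (hx : x ∈ T)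
    (m : ℕ) : x ^ m ∈ T ∧ F (x ^ m) = F x ^ m := by
  induction m with
  | zero => simpa using h1
  | succ m ih =>
    have := hmul _ ih.1 x hx ((Commute.refl x).pow_left m)
    rw [pow_succ, pow_succ, ← ih.2]
    exact this

theorem map_list_prod_of_commute (h1 : 1 ∈ T ∧ F 1 = 1)
    (hmul : ∀ x ∈ T, ∀ y ∈ T, Commute x y → x * y ∈ T ∧ F (x * y) = F x * F y) (l : List G)
    (hl : ∀ x ∈ l, x ∈ T) (hc : ∀ x ∈ l, ∀ y ∈ l, Commute x y) :
    l.prod ∈ T ∧ F l.prod = (l.map F).prod := by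
  induction l with
  | nil => simpa using h1
  | cons a l ih =>
    have ih := ih (fun x hx => hl x (List.mem_cons_of_mem _ hx))
      (fun x hx y hy => hc x (List.mem_cons_of_mem _ hx) y (List.mem_cons_of_mem _ hy))
    rw [List.prod_cons, List.map_cons, List.prod_cons, ← ih.2]
    exact hmul a (hl a List.mem_cons_self) _ ih.1 (Commute.list_prod_right _ _ fun y hy =>
      hc a List.mem_cons_self y (List.mem_cons_of_mem _ hy))

end PartialHom

theorem map_rowProd {G H : Type*} [Group G] [Group H] (f : G →* H) {d s : ℕ} (c : Fin s → ZMod d)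
    (x : Fin s → G) : f (rowProd c x) = rowProd c fun k => f (x k) := by
  simp [rowProd, map_list_prod, List.map_ofFn, Function.comp_def]

/-! ### Passing between solutions and homomorphisms -/

section Solutions

variable {p n r s : ℕ} [Fact p.Prime] {A : Matrix (Fin r) (Fin s) (ZMod p)} {b : Fin r → ZMod p}

local notation "χ" => ZMod.toCircle

/-- The phase `F (x k)` is a `p`-th root of unity, and its exponent is the classical value. Every
row is a product of commuting powers, so `F` carries the operator equation to the scalar one. -/
theorem exists_classicalSolution [Fact (p ≠ 2)] (hn : 1 ≤ n)
    {x : Fin s → Matrix.unitaryGroup (Fin n → ZMod p) ℂ} (hx : IsQuantumSolution A b x)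
    (hloc : ∀ k, x k ∈ localClifford p n) : ∃ t, IsClassicalSolution A b t := by
  obtain ⟨F, hFι, hmul⟩ := exists_phase_tensorTorsionSet (p := p) hn
  have h1 : 1 ∈ tensorTorsionSet p n ∧ F 1 = 1 := by simpa using hFι 1
  have hT : ∀ k, x k ∈ tensorTorsionSet p n := fun k =>
    mem_tensorTorsionSet (hloc k) (hx.torsion k)
  have hroot : ∀ k, ∃ t : ZMod p, F (x k) = χ t := fun k => exists_toCircle_eq (by
    rw [← (map_pow_of_commute h1 hmul (hT k) p).2, hx.torsion, h1.2])
  choose t ht using hroot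
  refine ⟨t, funext fun j => toCircle_inj ?_⟩
  have hrow : rowProd (A j) x = scalarHom _ (χ (b j)) :=
    Subtype.ext (by rw [hx.constraint j, coe_scalarHom, omega_pow_val])
  have h2 := (map_list_prod_of_commute h1 hmul (List.ofFn fun k => x k ^ (A j k).val) (by
    rintro _ hy
    obtain ⟨k, rfl⟩ := List.mem_ofFn.1 hy
    exact (map_pow_of_commute h1 hmul (hT k) _).1) (by
    rintro _ hy _ hy'
    obtain ⟨k, rfl⟩ := List.mem_ofFn.1 hy
    obtain ⟨k', rfl⟩ := List.mem_ofFn.1 hy'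
    -- Commutation is given only on the support of the row; off it the factor is a zeroth power,
    -- hence `1`.
    by_cases hk : A j k = 0
    · simp [hk]
    by_cases hk' : A j k' = 0
    · simp [hk']
    exact (hx.comm j k k' hk hk').pow_pow _ _)).2
  rw [← rowProd, hrow, (hFι _).2, List.map_ofFn, List.prod_ofFn] at h2
  have hsum : χ (∑ k, A j k * t k) = ∏ k, χ (A j k * t k) :=
    map_prod (χ : AddChar (ZMod p) Circle).toMonoidHom _ _
  rw [h2, Matrix.mulVec, dotProduct, hsum]
  refine Finset.prod_congr rfl fun k _ => ?_
  rw [Function.comp_apply, (map_pow_of_commute h1 hmul (hT k) _).2, ht, ← AddChar.map_nsmul_eq_pow,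
    nsmul_eq_mul, ZMod.natCast_zmod_val]

theorem exists_classicalHom {t : Fin s → ZMod p} (ht : IsClassicalSolution A b t) :
    ∃ η : SolutionGroup A b →* Multiplicative (ZMod p), IsClassicalHom η := by
  let f : Gen s → Multiplicative (ZMod p) := fun g =>
    match g with
    | Gen.J => Multiplicative.ofAdd 1
    | Gen.var k => Multiplicative.ofAdd (t k)
  have hJ : FreeGroup.lift f (freeJ s) = Multiplicative.ofAdd 1 := FreeGroup.lift_apply_of
  have hv : ∀ k, FreeGroup.lift f (freeVar k) = Multiplicative.ofAdd (t k) := fun k =>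
    FreeGroup.lift_apply_of
  have hp : ∀ a : Multiplicative (ZMod p), a ^ p = 1 := fun a =>
    Multiplicative.toAdd.injective (by simp)
  have hf : ∀ w ∈ {w : FreeGroup (Gen s) | IsRelator A b w}, FreeGroup.lift f w = 1 := by
    rintro w (_ | k | k | ⟨j, k, k', -, -⟩ | j)
    · rw [map_pow, hp]
    · rw [map_pow, hp]
    · simp only [map_mul, map_inv]
      rw [mul_comm (FreeGroup.lift f (freeJ s)), mul_inv_cancel_right, mul_inv_cancel]
    · simp only [map_mul, map_inv]
      rw [mul_comm (FreeGroup.lift f (freeVar k)), mul_inv_cancel_right, mul_inv_cancel]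
    · rw [map_mul, map_inv, mul_inv_eq_one, map_pow, hJ, map_rowProd]
      simp only [hv]
      apply Multiplicative.toAdd.injective
      have := congrFun ht j
      rw [rowProd, List.prod_ofFn, toAdd_prod, toAdd_pow]
      simpa [Matrix.mulVec, dotProduct] using this
  exact ⟨PresentedGroup.toGroup hf, PresentedGroup.toGroup.of hf⟩

/-- Compose with the scalar representation `t ↦ ω ^ t`; for `n ≥ 1` a scalar is a local Clifford
element, its phase being absorbed by one tensor factor. -/
theorem exists_quantumHom (hn : 1 ≤ n) {η : SolutionGroup A b →* Multiplicative (ZMod p)}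
    (hη : IsClassicalHom η) : ∃ η : SolutionGroup A b →* localClifford p n, IsQuantumHom η := by
  refine ⟨((scalarHom (Fin n → ZMod p)).codRestrict (localClifford p n)
    (scalarHom_mem_localClifford hn)).comp ((χ : AddChar (ZMod p) Circle).toMonoidHom.comp η), ?_⟩
  rw [IsQuantumHom, MonoidHom.comp_apply, MonoidHom.comp_apply, hη, omega_eq]
  rfl

theorem exists_quantumSolution {η : SolutionGroup A b →* localClifford p n}
    (hη : IsQuantumHom η) : ∃ x : Fin s → Matrix.unitaryGroup (Fin n → ZMod p) ℂ,
      IsQuantumSolution A b x ∧ ∀ k, x k ∈ localClifford p n := by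
  let g : FreeGroup (Gen s) →* Matrix.unitaryGroup (Fin n → ZMod p) ℂ :=
    ((localClifford p n).subtype.comp η).comp (PresentedGroup.mk _)
  have hg : ∀ w, IsRelator A b w → g w = 1 := by
    intro w hw
    have : PresentedGroup.mk {w : FreeGroup (Gen s) | IsRelator A b w} w = 1 :=
      PresentedGroup.one_of_mem hw
    simp only [g, MonoidHom.comp_apply, this, map_one]
  refine ⟨fun k => g (freeVar k), ⟨fun k => ?_, fun j k k' hk hk' => ?_, fun j => ?_⟩,
    fun k => (η _).2⟩
  · rw [← map_pow]
    exact hg _ (IsRelator.var_torsion k)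
  · have := hg _ (IsRelator.var_comm j k k' hk hk')
    rw [map_mul, map_mul, map_mul, map_inv, map_inv, mul_inv_eq_one, mul_inv_eq_iff_eq_mul] at this
    exact this
  · have := hg _ (IsRelator.row j)
    rw [map_mul, map_inv, mul_inv_eq_one, map_rowProd, map_pow] at this
    have hJ : g (freeJ s) = scalarHom _ (χ (1 : ZMod p)) :=
      Subtype.ext (hη.trans (by rw [omega_eq, coe_scalarHom]))
    rw [this, hJ, ← map_pow, ← AddChar.map_nsmul_eq_pow, coe_scalarHom, omega_pow_val]
    simp

end Solutions

end LCS

end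

theorem mainTheorem3 (p : ℕ) [Fact p.Prime] (hp : p ≠ 2) (n : ℕ) (hn : 1 ≤ n) (r s : ℕ)
    (A : Matrix (Fin r) (Fin s) (ZMod p)) (b : Fin r → ZMod p) :
    ((∃ η : LCS.SolutionGroup A b →* LCS.localClifford p n, LCS.IsQuantumHom η) ↔
      ∃ η : LCS.SolutionGroup A b →* Multiplicative (ZMod p), LCS.IsClassicalHom η) ∧
    ((∃ x : Fin s → Matrix.unitaryGroup (Fin n → ZMod p) ℂ,
        LCS.IsQuantumSolution A b x ∧ ∀ k, x k ∈ LCS.localClifford p n) ↔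
      ∃ x : Fin s → ZMod p, LCS.IsClassicalSolution A b x) := by
  have : Fact (p ≠ 2) := ⟨hp⟩
  refine ⟨⟨?_, ?_⟩, ?_, ?_⟩
  · rintro ⟨η, hη⟩
    obtain ⟨x, hx, hloc⟩ := LCS.exists_quantumSolution hη
    obtain ⟨t, ht⟩ := LCS.exists_classicalSolution hn hx hloc
    exact LCS.exists_classicalHom ht
  · rintro ⟨η, hη⟩
    exact LCS.exists_quantumHom hn hη
  · rintro ⟨x, hx, hloc⟩
    exact LCS.exists_classicalSolution hn hx hloc
  · rintro ⟨t, ht⟩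
    obtain ⟨η, hη⟩ := LCS.exists_classicalHom ht
    obtain ⟨η', hη'⟩ := LCS.exists_quantumHom hn hη
    exact LCS.exists_quantumSolution hη'
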